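/- Let $R$ be a commutative Noetherian ring, $\mathfrak a$ an ideal of $R$ and $M$ a finitely generated $R$-module. Write $H^i_{\mathfrak a}(M)$ for the $i$-th local cohomology module of $M$ with respect to $\mathfrak a$. An element $x\in\mathfrak a$ is called an $\mathfrak a$-filter regular element of a module $N$ if $x\notin\mathfrak p$ for every associated prime $\mathfrak p$ of $N$ with $\mathfrak a\not\subseteq\mathfrak p$; a sequence $x_1,\dots,x_t$ is called an $\mathfrak a$-filter regular sequence of $M$ if $x_i$ is an $\mathfrak a$-filter regular element of $M/(x_1,\dots,x_{i-1})M$ for every $i=1,\dots,t$. Let $t,n_0$ be positive integers such that $\mathfrak a^{n_0}H^i_{\mathfrak a}(M)=0$ for all $i<t$. Then for every $\mathfrak a$-filter regular sequence $x_1,\dots,x_t$ of $M$ contained in $\mathfrak a^{2n_0}$, and for all integers $0\le k\le n_0$ and $0\le j\le t$, there is an isomorphism of $R$-modules $$\operatorname{Hom}_R\bigl(R/\mathfrak a^k,\,M/(x_1,\dots,x_j)M\bigr)\;\cong\;\bigoplus_{i=0}^{j}\operatorname{Hom}_R\bigl(R/\mathfrak a^k,\,H^i_{\mathfrak a}(M)\bigr)^{\binom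 ji}.$$ In particular, up to isomorphism of $R$-modules, $\operatorname{Hom}_R(R/\mathfrak a^k, M/(x_1,\dots,x_j)M)$ is independent of the choice of the sequence: if $y_1,\dots,y_t$ is another $\mathfrak a$-filter regular sequence of $M$ contained in $\mathfrak a^{2n_0}$, then $\operatorname{Hom}_R(R/\mathfrak a^k, M/(x_1,\dots,x_j)M)\cong\operatorname{Hom}_R(R/\mathfrak a^k, M/(y_1,\dots,y_j)M)$ for all such $k$ and $j$. -/

import Mathlib

universe u v

open scoped DirectSum

/-- The `i`-th local cohomology module `H^i_𝔞(M) = colim_n Ext^i_R(R/𝔞^n, M)`. -/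
noncomputable abbrev localCohomologyModule {R : Type u} [CommRing R] (𝔞 : Ideal R) (i : ℕ)
    (M : Type u) [AddCommGroup M] [Module R M] : ModuleCat.{u} R :=
  (localCohomology 𝔞 i).obj (ModuleCat.of R M)

/-- `x` is an `𝔞`-filter regular element of `M`: it lies in `𝔞` and in no associated prime of `M`
outside `V(𝔞)`. -/
def IsFilterRegularElement {R : Type u} [CommRing R] (𝔞 : Ideal R)
    (M : Type v) [AddCommGroup M] [Module R M] (x : R) : Prop :=
  x ∈ 𝔞 ∧ ∀ 𝔭 ∈ associatedPrimes R M, ¬ 𝔞 ≤ 𝔭 → x ∉ 𝔭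

/-- The quotient `M/(x₁,…,xⱼ)M` by the first `j` members of the sequence `xs`. -/
abbrev QuotPrefix {R : Type u} [CommRing R] (M : Type v) [AddCommGroup M] [Module R M]
    (xs : List R) (j : ℕ) : Type v :=
  M ⧸ (Ideal.ofList (xs.take j) • (⊤ : Submodule R M))

/-- `xs = x₁,…,xₜ` is an `𝔞`-filter regular sequence of `M`: each member `xᵢ` is an
`𝔞`-filter regular element of `M/(x₁,…,xᵢ₋₁)M`. (List positions are counted from zero.) -/
def IsFilterRegularSequence {R : Type u} [CommRing R] (𝔞 : Ideal R)
    (M : Type v) [AddCommGroup M] [Module R M] (xs : List R) : Prop :=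
  ∀ (i : ℕ) (h : i < xs.length), IsFilterRegularElement 𝔞 (QuotPrefix M xs i) xs[i]

/-! Write J = 𝔞^n₀. Everything rests on a single x ∈ J². Its annihilator K in M is 𝔞-power torsion
by filter regularity, so M and M/K have the same local cohomology in positive degrees, and x induces
0 → M/K → M → M/xM → 0. If J kills H^i(M), the long exact sequence leaves 0 → H^i(M) → H^i(M/xM) →
H^(i+1)(M). It splits over the J-torsion of the last term: write x = ∑ a_l b_l with a_l, b_l ∈ J,
factor M/K → M as (b_l) : M/K → Mⁿ followed by (a_l) : Mⁿ → M, and let C be the cokernel of (b_l). A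
J-torsion class is killed by every b_l, so it lifts to H^i(C); since the a_l kill H^i(M), its image
in H^i(M/xM) does not depend on the lift. This is `exists_splitting`.

Hence Hom(R/𝔞^k, H^i(M/xM)) is the sum of the Homs into H^i(M) and H^(i+1)(M), and J still kills
H^i(M/xM) in one degree fewer, with the same exponent. Replacing M by M/xM and using Pascal's rule
yields the binomials (`nonempty_hom_quotPrefix_equiv`).

The supporting theory is the long exact sequence, carried over from `Abelian.Ext` to the colimit,
and the vanishing of higher local cohomology on torsion modules
(`subsingleton_of_powTorsion_eq_top`), which comes from Artin–Rees. -/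

section

open CategoryTheory Abelian Limits Opposite

/-! ### Comparison of the derived-functor `Ext` with `Abelian.Ext`, natural in both variables. -/

namespace CategoryTheory.ProjectiveResolution
variable {R : Type u} [CommRing R] {X X' Y Y' : ModuleCat.{u} R}

/-- There are no coboundaries in degree 0: one would come from a map out of the cohomological degree
1 term of the resolution, which is zero. -/
lemma eq_zero_of_extMk_zero_eq_zero (P : ProjectiveResolution X) (f : P.complex.X 0 ⟶ Y)
    (hf : P.complex.d 1 0 ≫ f = 0) (h : P.extMk f 1 rfl hf = 0) : f = 0 := by
  have := hf
  rw [← P.extEquivCohomologyClass.apply_eq_iff_eq, extEquivCohomologyClass_extMk,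
    extEquivCohomologyClass_zero, CochainComplex.HomComplex.CohomologyClass.mk_eq_zero_iff,
    CochainComplex.HomComplex.Cocycle.toSingleMk_mem_coboundaries_iff _ _ _ _ _ 1 (by simp)] at h
  obtain ⟨g, hg⟩ := h
  have hz : IsZero (P.cochainComplex.X 1) :=
    P.cochainComplex.isZero_of_isStrictlyLE 0 1 (by simp)
  rw [hz.eq_of_src g 0, comp_zero] at hg
  exact (cancel_epi (P.cochainComplexXIso (-(0 : ℕ)) 0 rfl).hom).1 (by rw [← hg, comp_zero])

/-- Functoriality of `Hom(P, Y)` in `Y`. -/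
noncomputable def linearYonedaObjMap (P : ProjectiveResolution X) (g : Y ⟶ Y') :
    P.complex.linearYonedaObj R Y ⟶ P.complex.linearYonedaObj R Y' :=
  (HomologicalComplex.unopFunctor _ _).map
    ((NatTrans.mapHomologicalComplex (NatTrans.rightOp ((linearYoneda R _).map g)) _).app
      P.complex).op

/-- Functoriality of `Hom(P, Y)` in `P`. -/
noncomputable def linearYonedaObjPrecomp {P : ProjectiveResolution X}
    {P' : ProjectiveResolution X'} (φ : P'.complex ⟶ P.complex) (Y : ModuleCat.{u} R) :
    P.complex.linearYonedaObj R Y ⟶ P'.complex.linearYonedaObj R Y :=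
  (HomologicalComplex.unopFunctor _ _).map
    ((((linearYoneda R (ModuleCat.{u} R)).obj Y).rightOp.mapHomologicalComplex _).map φ).op

lemma _root_.HomologicalComplex.homologyUnop_inv_naturality
    {K L : HomologicalComplex (ModuleCat.{u} R)ᵒᵖ (ComplexShape.down ℕ)} (φ : K ⟶ L) (n : ℕ) :
    (L.homologyUnop n).inv ≫ (HomologicalComplex.homologyMap (K := L.unop) (L := K.unop)
        ((HomologicalComplex.unopFunctor _ _).map φ.op) n : L.unop.homology n ⟶ K.unop.homology n) =
      (HomologicalComplex.homologyMap φ n).unop ≫ (K.homologyUnop n).inv := by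
  rw [Iso.inv_comp_eq, ← Category.assoc, Iso.eq_comp_inv]
  exact (congrArg Quiver.Hom.unop (HomologicalComplex.homologyOp_hom_naturality
    (K := L.unop) (L := K.unop) ((HomologicalComplex.unopFunctor _ _).map φ.op) n)).symm

lemma comp_comp_eq_of_square {C : Type*} [Category* C] {A B A₁ B₁ A₂ B₂ : C} {m : A ⟶ B}
    {i : A ⟶ A₁} {k : A₁ ⟶ B₁} {j' : B ⟶ B₁} {p : B₁ ⟶ B₂} {q : A₁ ⟶ A₂}
    {w : A₂ ⟶ B₂} (h : m ≫ j' = i ≫ k) (e : q ≫ w = k ≫ p) :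
    m ≫ (j' ≫ p) = (i ≫ q) ≫ w := by
  rw [Category.assoc, e, ← Category.assoc, h, Category.assoc]

lemma isoExt_hom_naturality (P : ProjectiveResolution X) (n : ℕ) (g : Y ⟶ Y') :
    ((Ext R (ModuleCat.{u} R) n).obj (op X)).map g ≫ (P.isoExt n Y').hom =
      (P.isoExt n Y).hom ≫ HomologicalComplex.homologyMap (P.linearYonedaObjMap g) n := by
  refine comp_comp_eq_of_square (congrArg Quiver.Hom.unop (?_ : (P.isoLeftDerivedObj
    ((linearYoneda R _).obj Y').rightOp n).inv ≫
    (NatTrans.leftDerived (NatTrans.rightOp ((linearYoneda R _).map g)) n).app X = _ ≫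
    (P.isoLeftDerivedObj ((linearYoneda R _).obj Y).rightOp n).inv))
    (HomologicalComplex.homologyUnop_inv_naturality ((NatTrans.mapHomologicalComplex
      (NatTrans.rightOp ((linearYoneda R _).map g)) _).app P.complex) n)
  rw [leftDerived_app_eq _ P n, Iso.inv_hom_id_assoc]
  rfl

lemma isoExt_hom_naturality_left {P : ProjectiveResolution X} {P' : ProjectiveResolution X'}
    (f : X' ⟶ X) (φ : P'.complex ⟶ P.complex) (comm : φ.f 0 ≫ P.π.f 0 = P'.π.f 0 ≫ f) (n : ℕ)
    (Y : ModuleCat.{u} R) :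
    ((Ext R (ModuleCat.{u} R) n).map f.op).app Y ≫ (P'.isoExt n Y).hom =
      (P.isoExt n Y).hom ≫ HomologicalComplex.homologyMap (linearYonedaObjPrecomp φ Y) n :=
  comp_comp_eq_of_square (congrArg Quiver.Hom.unop
    (isoLeftDerivedObj_inv_naturality f P' P φ comm ((linearYoneda R _).obj Y).rightOp n))
    (HomologicalComplex.homologyUnop_inv_naturality
      ((((linearYoneda R (ModuleCat.{u} R)).obj Y).rightOp.mapHomologicalComplex _).map φ) n)

/-- `extMk` as a linear map on cocycles. -/
noncomputable def extMkLinear (P : ProjectiveResolution X) (n : ℕ) (Y : ModuleCat.{u} R) :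
    LinearMap.ker (Linear.leftComp R Y (P.complex.d (n + 1) n)) →ₗ[R] Abelian.Ext X Y n where
  toFun f := P.extMk f.1 (n + 1) rfl f.2
  map_add' f g := (P.add_extMk f.1 g.1 (n + 1) rfl f.2 g.2).symm
  map_smul' r f := by
    have h : P.complex.d (n + 1) n ≫ f.1 = 0 := f.2
    refine Eq.trans ?_ (((P.extMk f.1 (n + 1) rfl h).smul_eq_comp_mk₀ r).trans
      (P.extMk_comp_mk₀ f.1 (n + 1) rfl h _)).symm
    congr 1

lemma linearYonedaObj_iCycles_comp (P : ProjectiveResolution X) (n : ℕ) (Y : ModuleCat.{u} R)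
    (z : (P.complex.linearYonedaObj R Y).cycles n) :
    (P.complex.linearYonedaObj R Y).iCycles n z ∈
      LinearMap.ker (Linear.leftComp R Y (P.complex.d (n + 1) n)) := by
  exact ConcreteCategory.congr_hom ((P.complex.linearYonedaObj R Y).iCycles_d n (n+1)) z

/-- The map from cocycles of `Hom(P, Y)` to `Abelian.Ext X Y n`. -/
noncomputable def cyclesToExt (P : ProjectiveResolution X) (n : ℕ) (Y : ModuleCat.{u} R) :
   (P.complex.linearYonedaObj R Y).cycles n ⟶ ModuleCat.of R (Abelian.Ext X Y n) :=
  ModuleCat.ofHom (P.extMkLinear n Y ∘ₗ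
    LinearMap.codRestrict _ ((P.complex.linearYonedaObj R Y).iCycles n).hom
      (P.linearYonedaObj_iCycles_comp n Y))

lemma cyclesToExt_apply (P : ProjectiveResolution X) (n : ℕ) (Y : ModuleCat.{u} R)
    (z : (P.complex.linearYonedaObj R Y).cycles n) :
    P.cyclesToExt n Y z =
      P.extMk ((P.complex.linearYonedaObj R Y).iCycles n z : P.complex.X n ⟶ Y) (n + 1) rfl
        (P.linearYonedaObj_iCycles_comp n Y z) := rfl

lemma extMk_comp_d (P : ProjectiveResolution X) (m n : ℕ) (f : P.complex.X m ⟶ Y) :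
    P.extMk (P.complex.d n m ≫ f) (n + 1) rfl (by simp) = 0 := by
  -- The case `m + 1 ≠ n` matters: below, `m` is `prev n`, which is 0 itself for `n = 0`.
  by_cases h : m + 1 = n
  · rw [extMk_eq_zero_iff _ _ _ _ _ m h]
    exact ⟨f, rfl⟩
  · simp [P.complex.shape n m (by simpa using h)]

/-- The comparison from the cohomology of `Hom(P, Y)` to `Abelian.Ext X Y n`. -/
noncomputable def homologyToExt (P : ProjectiveResolution X) (n : ℕ) (Y : ModuleCat.{u} R) :
   (P.complex.linearYonedaObj R Y).homology n ⟶ ModuleCat.of R (Abelian.Ext X Y n) :=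
  ((P.complex.linearYonedaObj R Y).homologyIsCokernel _ n rfl).desc
    (CokernelCofork.ofπ (P.cyclesToExt n Y) (by
      ext f
      refine Eq.trans ?_ (P.extMk_comp_d ((ComplexShape.up ℕ).prev n) n f)
      change P.cyclesToExt n Y _ = _
      rw [cyclesToExt_apply]
      congr 1
      exact ConcreteCategory.congr_hom
        ((P.complex.linearYonedaObj R Y).toCycles_i ((ComplexShape.up ℕ).prev n) n) f))

lemma homologyToExt_homologyπ (P : ProjectiveResolution X) (n : ℕ) (Y : ModuleCat.{u} R)
    (z : (P.complex.linearYonedaObj R Y).cycles n) :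
    P.homologyToExt n Y ((P.complex.linearYonedaObj R Y).homologyπ n z) =
      P.extMk ((P.complex.linearYonedaObj R Y).iCycles n z : P.complex.X n ⟶ Y) (n + 1) rfl
        (P.linearYonedaObj_iCycles_comp n Y z) :=
  ConcreteCategory.congr_hom (((P.complex.linearYonedaObj R Y).homologyIsCokernel _ n rfl).fac
    (CokernelCofork.ofπ (P.cyclesToExt n Y) _) WalkingParallelPair.one) z

lemma homologyπ_surjective (K : CochainComplex (ModuleCat.{u} R) ℕ) (n : ℕ) :
    Function.Surjective (K.homologyπ n) :=
  (ModuleCat.epi_iff_surjective _).1 inferInstance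

lemma exists_cycle (K : CochainComplex (ModuleCat.{u} R) ℕ) (n : ℕ) (x : K.X n)
    (hx : K.d n (n + 1) x = 0) : ∃ z : K.cycles n, K.iCycles n z = x := by
  let f := ModuleCat.ofHom (LinearMap.toSpanSingleton R (K.X n) x)
  refine ⟨(K.liftCycles f (n + 1) (by simp) ?_).hom (1 : R), ?_⟩
  · ext; simpa [f] using hx
  · refine (ConcreteCategory.congr_hom (K.liftCycles_i f (n + 1) (by simp) _) (1 : R)).trans ?_
    simp [f]

lemma homologyπ_eq_zero (K : CochainComplex (ModuleCat.{u} R) ℕ) (m n : ℕ) (z : K.cycles n)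
    (x : K.X m)
    (h : K.d m n x = K.iCycles n z) : K.homologyπ n z = 0 := by
  have : K.toCycles m n x = z := by
    apply (ModuleCat.mono_iff_injective (K.iCycles n)).1 inferInstance
    exact (ConcreteCategory.congr_hom (K.toCycles_i m n) x).trans h
  rw [← this]
  exact ConcreteCategory.congr_hom (K.toCycles_comp_homologyπ m n) x

lemma homologyToExt_bijective (P : ProjectiveResolution X) (n : ℕ) (Y : ModuleCat.{u} R) :
    Function.Bijective (P.homologyToExt n Y) := by
  constructor
  · rw [injective_iff_map_eq_zero]
    intro h hh
    obtain ⟨z, rfl⟩ := homologyπ_surjective _ _ h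
    rw [homologyToExt_homologyπ] at hh
    cases n with
    | zero =>
      have := P.eq_zero_of_extMk_zero_eq_zero _ _ hh
      have hz : z = 0 := (ModuleCat.mono_iff_injective
        ((P.complex.linearYonedaObj R Y).iCycles 0)).1 inferInstance (this.trans (map_zero _).symm)
      rw [hz, map_zero]
    | succ n =>
      obtain ⟨g, hg⟩ := (P.extMk_eq_zero_iff _ _ _ _ n rfl).1 hh
      exact homologyπ_eq_zero _ n (n + 1) z g hg
  · intro e
    obtain ⟨f, hf, rfl⟩ := P.extMk_surjective e (n + 1) rfl
    obtain ⟨z, hz⟩ := exists_cycle (P.complex.linearYonedaObj R Y) n f hf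
    exact ⟨(P.complex.linearYonedaObj R Y).homologyπ n z, by
      rw [homologyToExt_homologyπ]; congr 1⟩

/-- The comparison of the two definitions of `Ext`. -/
noncomputable def extLinearEquiv (P : ProjectiveResolution X) (n : ℕ) (Y : ModuleCat.{u} R) :
    ((Ext R (ModuleCat.{u} R) n).obj (op X)).obj Y ≃ₗ[R] Abelian.Ext X Y n :=
  (P.isoExt n Y).toLinearEquiv ≪≫ₗ
    LinearEquiv.ofBijective (P.homologyToExt n Y).hom (P.homologyToExt_bijective n Y)

lemma extLinearEquiv_apply (P : ProjectiveResolution X) (n : ℕ) (Y : ModuleCat.{u} R)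
    (e : ((Ext R (ModuleCat.{u} R) n).obj (op X)).obj Y) :
    P.extLinearEquiv n Y e = P.homologyToExt n Y ((P.isoExt n Y).hom e) := rfl

lemma extLinearEquiv_map (P : ProjectiveResolution X) (n : ℕ) (g : Y ⟶ Y')
    (e : ((Ext R (ModuleCat.{u} R) n).obj (op X)).obj Y) :
    P.extLinearEquiv n Y' (((Ext R (ModuleCat.{u} R) n).obj (op X)).map g e) =
      (P.extLinearEquiv n Y e).comp (Abelian.Ext.mk₀ g) (add_zero n) := by
  rw [extLinearEquiv_apply, extLinearEquiv_apply]
  have := ConcreteCategory.congr_hom (P.isoExt_hom_naturality n g) e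
  refine (congrArg (P.homologyToExt n Y') this).trans ?_
  change P.homologyToExt n Y' (HomologicalComplex.homologyMap (P.linearYonedaObjMap g) n
    ((P.isoExt n Y).hom e)) = _
  obtain ⟨z, hz⟩ := homologyπ_surjective _ _ ((P.isoExt n Y).hom e)
  rw [← hz, homologyToExt_homologyπ]
  refine Eq.trans ?_ (P.extMk_comp_mk₀ _ _ _ _ _).symm
  refine (congrArg (P.homologyToExt n Y') (ConcreteCategory.congr_hom
    (HomologicalComplex.homologyπ_naturality (P.linearYonedaObjMap g) n) z)).trans ?_
  refine (P.homologyToExt_homologyπ _ _ _).trans ?_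
  congr 1
  exact ConcreteCategory.congr_hom (HomologicalComplex.cyclesMap_i (P.linearYonedaObjMap g) n) z

lemma extLinearEquiv_map_left (P : ProjectiveResolution X) (P' : ProjectiveResolution X')
    (n : ℕ) (f : X' ⟶ X)
    (e : ((Ext R (ModuleCat.{u} R) n).obj (op X)).obj Y) :
    P'.extLinearEquiv n Y (((Ext R (ModuleCat.{u} R) n).map f.op).app Y e) =
      (Abelian.Ext.mk₀ f).comp (P.extLinearEquiv n Y e) (zero_add n) := by
  rw [extLinearEquiv_apply, extLinearEquiv_apply]
  let φ : ProjectiveResolution.Hom P' P f := ⟨lift f P' P, lift_commutes_zero f P' P⟩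
  have := ConcreteCategory.congr_hom
    (isoExt_hom_naturality_left f φ.hom (lift_commutes_zero f P' P) n Y) e
  refine (congrArg (P'.homologyToExt n Y) this).trans ?_
  change P'.homologyToExt n Y (HomologicalComplex.homologyMap (linearYonedaObjPrecomp φ.hom Y) n
    ((P.isoExt n Y).hom e)) = _
  obtain ⟨z, hz⟩ := homologyπ_surjective _ _ ((P.isoExt n Y).hom e)
  rw [← hz, homologyToExt_homologyπ]
  refine Eq.trans ?_ (mk₀_comp_extMk _ _ _ _ φ).symm
  refine (congrArg (P'.homologyToExt n Y) (ConcreteCategory.congr_hom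
    (HomologicalComplex.homologyπ_naturality (linearYonedaObjPrecomp φ.hom Y) n) z)).trans ?_
  refine (P'.homologyToExt_homologyπ _ _ _).trans ?_
  congr 1
  exact ConcreteCategory.congr_hom
    (HomologicalComplex.cyclesMap_i (linearYonedaObjPrecomp φ.hom Y) n) z

end CategoryTheory.ProjectiveResolution

/-! ### Local cohomology as a colimit of `Abelian.Ext`. -/

namespace localCohomology
variable {R : Type u} [CommRing R] (𝔞 : Ideal R)

/-- The module `R/𝔞ⁿ`. -/
abbrev powQuot (n : ℕ) : ModuleCat.{u} R := ModuleCat.of R (R ⧸ 𝔞 ^ n)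

/-- The projection `R/𝔞ᵐ ⟶ R/𝔞ⁿ` for `n ≤ m`. -/
def powQuotMap {n m : ℕ} (h : n ≤ m) : powQuot 𝔞 m ⟶ powQuot 𝔞 n :=
  (ringModIdeals (idealPowersDiagram 𝔞)).map (homOfLE h).op

variable {M N : ModuleCat.{u} R}

/-- The canonical map `Ext^i(R/𝔞ⁿ, M) → H^i_𝔞(M)` into the colimit. -/
noncomputable def ofExt (i n : ℕ) (M : ModuleCat.{u} R) :
    Abelian.Ext (powQuot 𝔞 n) M i →ₗ[R] (localCohomology 𝔞 i).obj M :=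
  ((colimit.ι (diagram (idealPowersDiagram 𝔞) i) (op (op n))).app M).hom ∘ₗ
    ((projectiveResolution (powQuot 𝔞 n)).extLinearEquiv i M).symm.toLinearMap

/-- `H^i_𝔞(M)` is the colimit of `Ext^i(R/𝔞ⁿ, M)`. -/
noncomputable def isColimitEval (i : ℕ) (M : ModuleCat.{u} R) :
    IsColimit (((evaluation (ModuleCat.{u} R) (ModuleCat.{u} R)).obj M).mapCocone
      (colimit.cocone (diagram (idealPowersDiagram 𝔞) i))) :=
  isColimitOfPreserves _ (colimit.isColimit _)

lemma ofExt_extLinearEquiv (i n : ℕ)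
    (e : ((Ext R (ModuleCat.{u} R) i).obj (op (powQuot 𝔞 n))).obj M) :
    ofExt 𝔞 i n M ((projectiveResolution (powQuot 𝔞 n)).extLinearEquiv i M e) =
      (colimit.ι (diagram (idealPowersDiagram 𝔞) i) (op (op n))).app M e :=
  congrArg _ (LinearEquiv.symm_apply_apply _ _)


instance preservesColimitsOfShape_forget :
    PreservesColimitsOfShape (ℕᵒᵖ)ᵒᵖ (forget (ModuleCat.{u} R)) :=
  haveI : PreservesFilteredColimitsOfSize.{0, 0} (forget (ModuleCat.{u} R)) :=
    preservesFilteredColimitsOfSize_shrink _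
  PreservesFilteredColimitsOfSize.preserves_filtered_colimits _

/-- Together with `map_ofExt`, `ofExt_powQuotMap_comp` and `ofExt_eq_zero_iff`, this is the only
access to the colimit needed later. -/
lemma exists_ofExt (i : ℕ) (x : (localCohomology 𝔞 i).obj M) :
    ∃ (n : ℕ) (e : Abelian.Ext (powQuot 𝔞 n) M i), ofExt 𝔞 i n M e = x := by
  obtain ⟨j, y, hy⟩ := Concrete.isColimit_exists_rep _ (isColimitEval 𝔞 i M) x
  refine ⟨j.unop.unop, (projectiveResolution (powQuot 𝔞 j.unop.unop)).extLinearEquiv i M y, ?_⟩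
  refine Eq.trans ?_ hy
  exact ofExt_extLinearEquiv 𝔞 _ _ _

lemma map_ofExt (i n : ℕ) (g : M ⟶ N) (e : Abelian.Ext (powQuot 𝔞 n) M i) :
    (localCohomology 𝔞 i).map g (ofExt 𝔞 i n M e) =
      ofExt 𝔞 i n N (e.comp (Abelian.Ext.mk₀ g) (add_zero i)) := by
  obtain ⟨e, rfl⟩ := ((projectiveResolution (powQuot 𝔞 n)).extLinearEquiv i M).surjective e
  rw [← ProjectiveResolution.extLinearEquiv_map]
  rw [ofExt_extLinearEquiv, ofExt_extLinearEquiv]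
  exact (ConcreteCategory.congr_hom
    ((colimit.ι (diagram (idealPowersDiagram 𝔞) i) (op (op n))).naturality g) e).symm

lemma ofExt_powQuotMap_comp (i : ℕ) {n m : ℕ} (h : n ≤ m) (e : Abelian.Ext (powQuot 𝔞 n) M i) :
    ofExt 𝔞 i m M ((Abelian.Ext.mk₀ (powQuotMap 𝔞 h)).comp e (zero_add i)) =
      ofExt 𝔞 i n M e := by
  obtain ⟨e, rfl⟩ := ((projectiveResolution (powQuot 𝔞 n)).extLinearEquiv i M).surjective e
  rw [← ProjectiveResolution.extLinearEquiv_map_left _ (projectiveResolution (powQuot 𝔞 m))]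
  rw [ofExt_extLinearEquiv, ofExt_extLinearEquiv]
  exact ConcreteCategory.congr_hom (congrArg (fun t => t.app M)
    (colimit.w (diagram (idealPowersDiagram 𝔞) i) (homOfLE h).op.op)) e

lemma ofExt_eq_zero_iff (i n : ℕ) (e : Abelian.Ext (powQuot 𝔞 n) M i) :
    ofExt 𝔞 i n M e = 0 ↔
      ∃ (m : ℕ) (h : n ≤ m), (Abelian.Ext.mk₀ (powQuotMap 𝔞 h)).comp e (zero_add i) = 0 := by
  refine ⟨fun h => ?_, fun ⟨m, h, he⟩ => by rw [← ofExt_powQuotMap_comp 𝔞 i h, he, map_zero]⟩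
  obtain ⟨e, rfl⟩ := ((projectiveResolution (powQuot 𝔞 n)).extLinearEquiv i M).surjective e
  rw [ofExt_extLinearEquiv] at h
  obtain ⟨k, f, g, hfg⟩ := Concrete.isColimit_exists_of_rep_eq _ (isColimitEval 𝔞 i M)
    (i := op (op n)) (j := op (op n)) e 0 (h.trans (map_zero _).symm)
  rw [map_zero] at hfg
  refine ⟨k.unop.unop, f.unop.unop.le, ?_⟩
  rw [← ProjectiveResolution.extLinearEquiv_map_left _ (projectiveResolution (powQuot 𝔞 _))]
  exact (congrArg _ hfg).trans (map_zero _)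

end localCohomology

/-! ### Long exact sequence, and degree zero. -/

namespace localCohomology
variable {R : Type u} [CommRing R] (𝔞 : Ideal R)
variable {M N : ModuleCat.{u} R}

lemma exists_ofExt_of_le {i n : ℕ} (x : (localCohomology 𝔞 i).obj M)
    (hx : ∃ e : Abelian.Ext (powQuot 𝔞 n) M i, ofExt 𝔞 i n M e = x) {m : ℕ} (h : n ≤ m) :
    ∃ e : Abelian.Ext (powQuot 𝔞 m) M i, ofExt 𝔞 i m M e = x := by
  obtain ⟨e, rfl⟩ := hx
  exact ⟨_, ofExt_powQuotMap_comp 𝔞 i h e⟩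

lemma exists_ofExt₂ {i : ℕ} (x y : (localCohomology 𝔞 i).obj M) :
    ∃ (n : ℕ) (e e' : Abelian.Ext (powQuot 𝔞 n) M i),
      ofExt 𝔞 i n M e = x ∧ ofExt 𝔞 i n M e' = y := by
  obtain ⟨n, hn⟩ := exists_ofExt 𝔞 i x
  obtain ⟨m, hm⟩ := exists_ofExt 𝔞 i y
  obtain ⟨e, he⟩ := exists_ofExt_of_le 𝔞 x hn (le_max_left n m)
  obtain ⟨e', he'⟩ := exists_ofExt_of_le 𝔞 y hm (le_max_right n m)
  exact ⟨_, e, e', he, he'⟩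

section lift

variable {𝔞} {Q : Type*} [AddCommGroup Q] [Module R Q] {i : ℕ}
  (f : ∀ n, Abelian.Ext (powQuot 𝔞 n) M i →ₗ[R] Q)

/-- Two representatives agree at some stage beyond `max n m`, so the choice made in `lift` is
harmless. -/
lemma lift_aux (hf : ∀ (n m : ℕ) (h : n ≤ m) (e : Abelian.Ext (powQuot 𝔞 n) M i),
      f m ((Abelian.Ext.mk₀ (powQuotMap 𝔞 h)).comp e (zero_add i)) = f n e)
    {n m : ℕ} (e : Abelian.Ext (powQuot 𝔞 n) M i) (e' : Abelian.Ext (powQuot 𝔞 m) M i)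
    (h : ofExt 𝔞 i n M e = ofExt 𝔞 i m M e') : f n e = f m e' := by
  rw [← hf _ _ (le_max_left n m), ← hf _ _ (le_max_right n m) e', ← sub_eq_zero, ← map_sub]
  rw [← ofExt_powQuotMap_comp 𝔞 i (le_max_left n m),
    ← ofExt_powQuotMap_comp 𝔞 i (le_max_right n m) e', ← sub_eq_zero, ← map_sub,
    ofExt_eq_zero_iff] at h
  obtain ⟨k, hk, h⟩ := h
  rw [← hf _ _ hk, h, map_zero]

/-- The map out of `H^i_𝔞(M)` given by a compatible family of maps out of `Ext^i(R/𝔞ⁿ, M)`. -/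
noncomputable def lift (hf : ∀ (n m : ℕ) (h : n ≤ m) (e : Abelian.Ext (powQuot 𝔞 n) M i),
      f m ((Abelian.Ext.mk₀ (powQuotMap 𝔞 h)).comp e (zero_add i)) = f n e) :
    (localCohomology 𝔞 i).obj M →ₗ[R] Q where
  toFun x := f _ (exists_ofExt 𝔞 i x).choose_spec.choose
  map_add' x y := by
    obtain ⟨n, e, e', he, he'⟩ := exists_ofExt₂ 𝔞 x y
    rw [lift_aux f hf _ e ((exists_ofExt 𝔞 i x).choose_spec.choose_spec.trans he.symm),
      lift_aux f hf _ e' ((exists_ofExt 𝔞 i y).choose_spec.choose_spec.trans he'.symm),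
      ← map_add]
    exact lift_aux f hf _ _ ((exists_ofExt 𝔞 i (x + y)).choose_spec.choose_spec.trans
      (by rw [map_add, he, he']))
  map_smul' r x := by
    rw [RingHom.id_apply, ← map_smul]
    exact lift_aux f hf _ _ ((exists_ofExt 𝔞 i (r • x)).choose_spec.choose_spec.trans
      (by rw [map_smul, (exists_ofExt 𝔞 i x).choose_spec.choose_spec]))

lemma lift_ofExt (hf : ∀ (n m : ℕ) (h : n ≤ m) (e : Abelian.Ext (powQuot 𝔞 n) M i),
      f m ((Abelian.Ext.mk₀ (powQuotMap 𝔞 h)).comp e (zero_add i)) = f n e)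
    (n : ℕ) (e : Abelian.Ext (powQuot 𝔞 n) M i) : lift f hf (ofExt 𝔞 i n M e) = f n e :=
  lift_aux f hf _ _ (exists_ofExt 𝔞 i (ofExt 𝔞 i n M e)).choose_spec.choose_spec

end lift

instance (i : ℕ) : (localCohomology 𝔞 i).Additive where
  map_add {M N f g} := by
    ext x
    obtain ⟨n, e, rfl⟩ := exists_ofExt 𝔞 i x
    refine (map_ofExt 𝔞 i n (f + g) e).trans ?_
    rw [Abelian.Ext.mk₀_add, Abelian.Ext.comp_add, map_add, ← map_ofExt, ← map_ofExt]
    rfl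

instance (i : ℕ) : (localCohomology 𝔞 i).Linear R where
  map_smul {M N} f r := by
    ext x
    obtain ⟨n, e, rfl⟩ := exists_ofExt 𝔞 i x
    refine (map_ofExt 𝔞 i n (r • f) e).trans ?_
    rw [Abelian.Ext.mk₀_smul, Abelian.Ext.comp_smul, map_smul, ← map_ofExt]
    rfl

section connecting

variable {S S' : ShortComplex (ModuleCat.{u} R)} (hS : S.ShortExact) (hS' : S'.ShortExact)

/-- The connecting homomorphism, induced by the Yoneda product with the extension class. -/
noncomputable def δ (i : ℕ) :
    (localCohomology 𝔞 i).obj S.X₃ →ₗ[R] (localCohomology 𝔞 (i + 1)).obj S.X₁ :=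
  lift (fun n => ofExt 𝔞 (i + 1) n S.X₁ ∘ₗ
    hS.extClass.postcompOfLinear R (powQuot 𝔞 n) rfl) (fun n m h e => by
      refine Eq.trans ?_ (ofExt_powQuotMap_comp 𝔞 (i + 1) h (e.comp hS.extClass rfl))
      refine congrArg (ofExt 𝔞 (i + 1) m S.X₁) ?_
      exact Abelian.Ext.comp_assoc _ _ _ _ _ (by lia))

lemma δ_ofExt (i n : ℕ) (e : Abelian.Ext (powQuot 𝔞 n) S.X₃ i) :
    δ 𝔞 hS i (ofExt 𝔞 i n S.X₃ e) = ofExt 𝔞 (i + 1) n S.X₁ (e.comp hS.extClass rfl) :=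
  lift_ofExt _ _ n e

lemma map_g_map_f (i : ℕ) (x : (localCohomology 𝔞 i).obj S.X₁) :
    (localCohomology 𝔞 i).map S.g ((localCohomology 𝔞 i).map S.f x) = 0 := by
  rw [← ConcreteCategory.comp_apply, ← Functor.map_comp, S.zero, Functor.map_zero]
  rfl

lemma δ_map_g (i : ℕ) (x : (localCohomology 𝔞 i).obj S.X₂) :
    δ 𝔞 hS i ((localCohomology 𝔞 i).map S.g x) = 0 := by
  obtain ⟨n, e, rfl⟩ := exists_ofExt 𝔞 i x
  rw [map_ofExt, δ_ofExt, Abelian.Ext.comp_assoc_of_second_deg_zero, hS.comp_extClass,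
    Abelian.Ext.comp_zero, map_zero]

lemma map_f_δ (i : ℕ) (x : (localCohomology 𝔞 i).obj S.X₃) :
    (localCohomology 𝔞 (i + 1)).map S.f (δ 𝔞 hS i x) = 0 := by
  obtain ⟨n, e, rfl⟩ := exists_ofExt 𝔞 i x
  rw [δ_ofExt, map_ofExt, Abelian.Ext.comp_assoc_of_third_deg_zero, hS.extClass_comp,
    Abelian.Ext.comp_zero, map_zero]

-- This and the next two exactness lemmas share one argument: vanishing in the colimit becomes
-- vanishing in Ext at a later stage, where the covariant Ext sequence applies.
include hS in
lemma exists_of_map_g_eq_zero (i : ℕ) (x : (localCohomology 𝔞 i).obj S.X₂)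
    (hx : (localCohomology 𝔞 i).map S.g x = 0) :
    ∃ y, (localCohomology 𝔞 i).map S.f y = x := by
  obtain ⟨n, e, rfl⟩ := exists_ofExt 𝔞 i x
  rw [map_ofExt, ofExt_eq_zero_iff] at hx
  obtain ⟨m, h, he⟩ := hx
  rw [← Abelian.Ext.comp_assoc_of_third_deg_zero] at he
  obtain ⟨y, hy⟩ := Abelian.Ext.covariant_sequence_exact₂ _ hS _ he
  exact ⟨ofExt 𝔞 i m S.X₁ y, by rw [map_ofExt, hy, ofExt_powQuotMap_comp]⟩

lemma exists_of_δ_eq_zero (i : ℕ) (x : (localCohomology 𝔞 i).obj S.X₃)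
    (hx : δ 𝔞 hS i x = 0) :
    ∃ y, (localCohomology 𝔞 i).map S.g y = x := by
  obtain ⟨n, e, rfl⟩ := exists_ofExt 𝔞 i x
  rw [δ_ofExt, ofExt_eq_zero_iff] at hx
  obtain ⟨m, h, he⟩ := hx
  rw [← Abelian.Ext.comp_assoc _ _ _ (zero_add i) rfl (by lia)] at he
  obtain ⟨y, hy⟩ := Abelian.Ext.covariant_sequence_exact₃ _ hS _ rfl he
  exact ⟨ofExt 𝔞 i m S.X₂ y, by rw [map_ofExt, hy, ofExt_powQuotMap_comp]⟩

lemma exists_of_map_f_eq_zero (i : ℕ) (x : (localCohomology 𝔞 (i + 1)).obj S.X₁)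
    (hx : (localCohomology 𝔞 (i + 1)).map S.f x = 0) :
    ∃ y, δ 𝔞 hS i y = x := by
  obtain ⟨n, e, rfl⟩ := exists_ofExt 𝔞 (i + 1) x
  rw [map_ofExt, ofExt_eq_zero_iff] at hx
  obtain ⟨m, h, he⟩ := hx
  rw [← Abelian.Ext.comp_assoc_of_third_deg_zero] at he
  obtain ⟨y, hy⟩ := Abelian.Ext.covariant_sequence_exact₁ _ hS _ he rfl
  exact ⟨ofExt 𝔞 i m S.X₃ y, by rw [δ_ofExt, hy, ofExt_powQuotMap_comp]⟩

lemma map_δ (φ : S ⟶ S') (i : ℕ) (x : (localCohomology 𝔞 i).obj S.X₃) :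
    (localCohomology 𝔞 (i + 1)).map φ.τ₁ (δ 𝔞 hS i x) =
      δ 𝔞 hS' i ((localCohomology 𝔞 i).map φ.τ₃ x) := by
  obtain ⟨n, e, rfl⟩ := exists_ofExt 𝔞 i x
  rw [δ_ofExt, map_ofExt, map_ofExt, δ_ofExt, Abelian.Ext.comp_assoc_of_third_deg_zero,
    ShortComplex.ShortExact.extClass_naturality hS hS' φ,
    Abelian.Ext.comp_assoc_of_second_deg_zero]

end connecting

lemma subsingleton_of_injective (i : ℕ) (E : ModuleCat.{u} R) [Injective E] :
    Subsingleton ((localCohomology 𝔞 (i + 1)).obj E) := by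
  refine subsingleton_of_forall_eq 0 fun x => ?_
  obtain ⟨n, e, rfl⟩ := exists_ofExt 𝔞 (i + 1) x
  rw [e.eq_zero_of_injective, map_zero]

section zero

/-- Evaluation at `1` of an element of `Ext⁰(R/𝔞ⁿ, M) = Hom(R/𝔞ⁿ, M)`. -/
noncomputable def evalOne (n : ℕ) (M : ModuleCat.{u} R) :
    Abelian.Ext (powQuot 𝔞 n) M 0 →ₗ[R] M :=
  LinearMap.applyₗ (1 : R ⧸ 𝔞 ^ n) ∘ₗ (ModuleCat.homLinearEquiv (S := R)).toLinearMap ∘ₗ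
    (Abelian.Ext.linearEquiv₀ (R := R) (X := powQuot 𝔞 n) (Y := M)).toLinearMap

lemma evalOne_mk₀ (n : ℕ) (f : powQuot 𝔞 n ⟶ M) :
    evalOne 𝔞 n M (Abelian.Ext.mk₀ f) = f (1 : R ⧸ 𝔞 ^ n) := by
  have : Abelian.Ext.linearEquiv₀ (R := R) (Abelian.Ext.mk₀ f) = f :=
    (Abelian.Ext.linearEquiv₀ (R := R)).apply_symm_apply f
  change (Abelian.Ext.linearEquiv₀ (R := R) (Abelian.Ext.mk₀ f)).hom (1 : R ⧸ 𝔞 ^ n) = _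
  rw [this]

/-- The canonical map `H^0_𝔞(M) → M`. -/
noncomputable def zeroToSelf (M : ModuleCat.{u} R) : (localCohomology 𝔞 0).obj M →ₗ[R] M :=
  lift (fun n => evalOne 𝔞 n M) (fun n m h e => by
    obtain ⟨f, rfl⟩ := (Abelian.Ext.mk₀_bijective _ _).2 e
    rw [Abelian.Ext.mk₀_comp_mk₀, evalOne_mk₀, evalOne_mk₀]
    rfl)

lemma zeroToSelf_mk₀ (n : ℕ) (f : powQuot 𝔞 n ⟶ M) :
    zeroToSelf 𝔞 M (ofExt 𝔞 0 n M (Abelian.Ext.mk₀ f)) = f (1 : R ⧸ 𝔞 ^ n) :=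
  (lift_ofExt _ _ n _).trans (evalOne_mk₀ 𝔞 n f)

lemma exists_mk₀ (x : (localCohomology 𝔞 0).obj M) :
    ∃ (n : ℕ) (f : powQuot 𝔞 n ⟶ M), ofExt 𝔞 0 n M (Abelian.Ext.mk₀ f) = x := by
  obtain ⟨n, e, rfl⟩ := exists_ofExt 𝔞 0 x
  obtain ⟨f, rfl⟩ := (Abelian.Ext.mk₀_bijective _ _).2 e
  exact ⟨n, f, rfl⟩

lemma zeroToSelf_injective : Function.Injective (zeroToSelf 𝔞 M) := by
  rw [injective_iff_map_eq_zero]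
  intro x hx
  obtain ⟨n, f, rfl⟩ := exists_mk₀ 𝔞 x
  rw [zeroToSelf_mk₀] at hx
  have : f = 0 := by
    refine ModuleCat.hom_ext (LinearMap.ext fun y => ?_)
    obtain ⟨r, rfl⟩ := Ideal.Quotient.mk_surjective y
    have : Ideal.Quotient.mk (𝔞 ^ n) r = r • (1 : R ⧸ 𝔞 ^ n) := by
      rw [Algebra.smul_def, mul_one]; rfl
    change f (Ideal.Quotient.mk (𝔞 ^ n) r) = 0
    rw [this]
    refine (map_smul f.hom r (1 : R ⧸ 𝔞 ^ n)).trans ?_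
    exact (congrArg (r • ·) hx).trans (smul_zero r)
  rw [this, Abelian.Ext.mk₀_zero, map_zero]

lemma zeroToSelf_map (g : M ⟶ N) (x : (localCohomology 𝔞 0).obj M) :
    zeroToSelf 𝔞 N ((localCohomology 𝔞 0).map g x) = g (zeroToSelf 𝔞 M x) := by
  obtain ⟨n, f, rfl⟩ := exists_mk₀ 𝔞 x
  rw [map_ofExt, Abelian.Ext.mk₀_comp_mk₀, zeroToSelf_mk₀, zeroToSelf_mk₀]
  rfl

lemma mem_range_zeroToSelf_iff (m : M) : m ∈ LinearMap.range (zeroToSelf 𝔞 M) ↔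
    ∃ n, ∀ r ∈ 𝔞 ^ n, r • m = 0 := by
  constructor
  · rintro ⟨x, rfl⟩
    obtain ⟨n, f, rfl⟩ := exists_mk₀ 𝔞 x
    refine ⟨n, fun r hr => ?_⟩
    rw [zeroToSelf_mk₀]
    refine (map_smul f.hom r (1 : R ⧸ 𝔞 ^ n)).symm.trans ?_
    rw [Algebra.smul_def, mul_one]
    exact (congrArg f (Ideal.Quotient.eq_zero_iff_mem.2 hr)).trans (map_zero _)
  · rintro ⟨n, hn⟩
    refine ⟨ofExt 𝔞 0 n M (Abelian.Ext.mk₀ (ModuleCat.ofHom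
      ((𝔞 ^ n).liftQ (LinearMap.toSpanSingleton R M m) hn))), ?_⟩
    rw [zeroToSelf_mk₀]
    exact one_smul R m

end zero

end localCohomology

/-! ### Power torsion of modules and of injective modules. -/

section powTorsion

variable {R : Type u} [CommRing R] (𝔞 : Ideal R)

/-- The submodule `Γ_𝔞(M)` of elements killed by a power of `𝔞`. -/
def powTorsion (M : Type v) [AddCommGroup M] [Module R M] : Submodule R M where
  carrier := {m | ∃ n, ∀ r ∈ 𝔞 ^ n, r • m = 0}
  zero_mem' := ⟨0, fun r _ => smul_zero r⟩
  add_mem' := by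
    rintro a b ⟨n, hn⟩ ⟨m, hm⟩
    refine ⟨n + m, fun r hr => ?_⟩
    rw [smul_add, hn r (Ideal.pow_le_pow_right (by lia) hr),
      hm r (Ideal.pow_le_pow_right (by lia) hr), add_zero]
  smul_mem' := by
    rintro c a ⟨n, hn⟩
    exact ⟨n, fun r hr => by rw [smul_comm, hn r hr, smul_zero]⟩

variable {M : Type v} [AddCommGroup M] [Module R M]

variable (M) in
lemma powTorsion_powTorsion : powTorsion 𝔞 (powTorsion 𝔞 M) = ⊤ := by
  refine eq_top_iff.2 fun m _ => ?_
  obtain ⟨n, hn⟩ := m.2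
  exact ⟨n, fun r hr => Subtype.ext (hn r hr)⟩

lemma exists_pow_smul_eq_zero_of_fg {N : Submodule R M} (hfg : N.FG) (hN : N ≤ powTorsion 𝔞 M) :
    ∃ n, ∀ r ∈ 𝔞 ^ n, ∀ m ∈ N, r • m = 0 := by
  induction N, hfg using Submodule.fg_induction with
  | singleton x =>
    obtain ⟨n, hn⟩ := hN (Submodule.mem_span_singleton_self x)
    refine ⟨n, fun r hr m hm => ?_⟩
    obtain ⟨c, rfl⟩ := Submodule.mem_span_singleton.1 hm
    rw [smul_comm, hn r hr, smul_zero]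
  | sup N₁ N₂ _ _ h₁ h₂ =>
    obtain ⟨n₁, h₁⟩ := h₁ (le_sup_left.trans hN)
    obtain ⟨n₂, h₂⟩ := h₂ (le_sup_right.trans hN)
    refine ⟨n₁ + n₂, fun r hr m hm => ?_⟩
    obtain ⟨a, ha, b, hb, rfl⟩ := Submodule.mem_sup.1 hm
    rw [smul_add, h₁ r (Ideal.pow_le_pow_right (by lia) hr) a ha,
      h₂ r (Ideal.pow_le_pow_right (by lia) hr) b hb, add_zero]

/-- Over a Noetherian ring, the `𝔞`-power torsion of an injective module is injective. -/
lemma injective_powTorsion [IsNoetherianRing R] (E : Type u) [AddCommGroup E] [Module R E]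
    [Module.Injective R E] : Module.Injective R (powTorsion 𝔞 E) := by
  refine Module.Baer.injective fun I g => ?_
  obtain ⟨n, hn⟩ := exists_pow_smul_eq_zero_of_fg 𝔞 (N := LinearMap.range g)
    (by rw [LinearMap.range_eq_map]; exact (IsNoetherian.noetherian _).map g) (by
    rw [powTorsion_powTorsion]; exact le_top)
  -- Artin–Rees: 𝔞^(k+n) ∩ I ⊆ 𝔞^n I, and `g` vanishes on the latter.
  obtain ⟨k, hk⟩ := Ideal.exists_pow_inf_eq_pow_smul 𝔞 I
  have hle : 𝔞 ^ (k + n) ⊓ I ≤ 𝔞 ^ n • I := by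
    have := hk (k + n) (by lia)
    rw [smul_eq_mul, Ideal.mul_top, Nat.add_sub_cancel_left] at this
    rw [this]
    exact Submodule.smul_mono le_rfl inf_le_right
  have hg : ∀ x (hx : x ∈ 𝔞 ^ n • I), ∃ hI : x ∈ I, g ⟨x, hI⟩ = 0 := by
    intro x hx
    refine Submodule.smul_induction_on hx (fun r hr y hy => ⟨I.mul_mem_left r hy, ?_⟩) ?_
    · have : (⟨r • y, I.mul_mem_left r hy⟩ : I) = r • (⟨y, hy⟩ : I) := rfl
      rw [this, map_smul]
      exact hn r hr _ ⟨_, rfl⟩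
    · rintro x y ⟨hx, hx'⟩ ⟨hy, hy'⟩
      refine ⟨I.add_mem hx hy, ?_⟩
      have : (⟨x + y, I.add_mem hx hy⟩ : I) = ⟨x, hx⟩ + ⟨y, hy⟩ := rfl
      rw [this, map_add, hx', hy', add_zero]
  let J : Submodule R R := 𝔞 ^ (k + n)
  -- Thus `g` factors through I/(I ∩ 𝔞^(k+n)), which embeds in R/𝔞^(k+n). Extending from there,
  -- rather than from `I` to `R`, forces the values of the extension to be torsion.
  let p := Submodule.mapQ (J.comap I.subtype) J I.subtype le_rfl
  have hp : Function.Injective p := by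
    rw [← LinearMap.ker_eq_bot, Submodule.ker_mapQ]
    simp
  let q : (I ⧸ J.comap I.subtype) →ₗ[R] E :=
    (J.comap I.subtype).liftQ ((powTorsion 𝔞 E).subtype ∘ₗ g) (by
      intro x hx
      obtain ⟨_, h⟩ := hg x (hle ⟨hx, x.2⟩)
      rw [LinearMap.mem_ker, LinearMap.comp_apply, h, map_zero])
  obtain ⟨h, hh⟩ := Module.Injective.extension_property R E _ _ p hp q
  have hmem : ∀ r, (h ∘ₗ J.mkQ) r ∈ powTorsion 𝔞 E := fun r => ⟨k + n, fun s hs => by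
    have : J.mkQ (s • r) = 0 := by
      rw [Submodule.mkQ_apply, Submodule.Quotient.mk_eq_zero]
      exact Ideal.mul_mem_right r _ hs
    rw [← map_smul, LinearMap.comp_apply, this, map_zero]⟩
  refine ⟨LinearMap.codRestrict _ (h ∘ₗ J.mkQ) hmem, fun x hx => Subtype.ext ?_⟩
  exact LinearMap.congr_fun hh (Submodule.Quotient.mk ⟨x, hx⟩)

end powTorsion

/-! ### Linear-map form of the theory, and vanishing on torsion modules. -/

namespace localCohomology

variable {R : Type u} [CommRing R] (𝔞 : Ideal R)
variable {A B C A' B' C' : Type u} [AddCommGroup A] [Module R A] [AddCommGroup B] [Module R B]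
  [AddCommGroup C] [Module R C] [AddCommGroup A'] [Module R A'] [AddCommGroup B'] [Module R B']
  [AddCommGroup C'] [Module R C']

/-- The map induced on local cohomology by a linear map. -/
noncomputable def lmap (i : ℕ) (f : A →ₗ[R] B) :
    localCohomologyModule 𝔞 i A →ₗ[R] localCohomologyModule 𝔞 i B :=
  ((localCohomology 𝔞 i).map (ModuleCat.ofHom f)).hom

lemma lmap_id (i : ℕ) : lmap 𝔞 i (LinearMap.id : A →ₗ[R] A) = LinearMap.id :=
  congrArg ModuleCat.Hom.hom ((localCohomology 𝔞 i).map_id (ModuleCat.of R A))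

lemma lmap_comp (i : ℕ) (g : B →ₗ[R] C) (f : A →ₗ[R] B) :
    lmap 𝔞 i (g ∘ₗ f) = lmap 𝔞 i g ∘ₗ lmap 𝔞 i f :=
  congrArg ModuleCat.Hom.hom
    ((localCohomology 𝔞 i).map_comp (ModuleCat.ofHom f) (ModuleCat.ofHom g))

lemma lmap_comp_apply (i : ℕ) (g : B →ₗ[R] C) (f : A →ₗ[R] B) (x : localCohomologyModule 𝔞 i A) :
    lmap 𝔞 i (g ∘ₗ f) x = lmap 𝔞 i g (lmap 𝔞 i f x) := by
  rw [lmap_comp]; rfl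

lemma lmap_add (i : ℕ) (f g : A →ₗ[R] B) : lmap 𝔞 i (f + g) = lmap 𝔞 i f + lmap 𝔞 i g :=
  congrArg ModuleCat.Hom.hom
    ((localCohomology 𝔞 i).map_add (f := ModuleCat.ofHom f) (g := ModuleCat.ofHom g))

lemma lmap_smul (i : ℕ) (r : R) (f : A →ₗ[R] B) : lmap 𝔞 i (r • f) = r • lmap 𝔞 i f :=
  congrArg ModuleCat.Hom.hom (Functor.map_smul (localCohomology 𝔞 i) r (ModuleCat.ofHom f))

lemma lmap_zero (i : ℕ) : lmap 𝔞 i (0 : A →ₗ[R] B) = 0 := by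
  simpa using lmap_smul 𝔞 i (0 : R) (0 : A →ₗ[R] B)

lemma lmap_sum {ι : Type*} (i : ℕ) (s : Finset ι) (f : ι → A →ₗ[R] B) :
    lmap 𝔞 i (∑ l ∈ s, f l) = ∑ l ∈ s, lmap 𝔞 i (f l) := by
  classical
  induction s using Finset.induction_on with
  | empty => simp [lmap_zero]
  | insert a s ha ih => rw [Finset.sum_insert ha, lmap_add, ih, Finset.sum_insert ha]

section connecting

variable {f : A →ₗ[R] B} {g : B →ₗ[R] C} (hf : Function.Injective f) (hg : Function.Surjective g)
  (hfg : Function.Exact f g)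
  {f' : A' →ₗ[R] B'} {g' : B' →ₗ[R] C'} (hf' : Function.Injective f')
  (hg' : Function.Surjective g') (hfg' : Function.Exact f' g')

include hf hg hfg in
lemma shortExact_of_exact : (ShortComplex.moduleCatMk f g hfg.linearMap_comp_eq_zero).ShortExact :=
  ModuleCat.shortComplex_shortExact _ hfg hf hg

/-- The connecting homomorphism of local cohomology. -/
noncomputable def conn (i : ℕ) :
    localCohomologyModule 𝔞 i C →ₗ[R] localCohomologyModule 𝔞 (i + 1) A :=
  δ 𝔞 (shortExact_of_exact hf hg hfg) i

include hf hg hfg in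
lemma exact_lmap_lmap (i : ℕ) : Function.Exact (lmap 𝔞 i f) (lmap 𝔞 i g) := fun x =>
  ⟨exists_of_map_g_eq_zero 𝔞 (shortExact_of_exact hf hg hfg) i x, by
    rintro ⟨y, rfl⟩
    exact map_g_map_f 𝔞 (S := ShortComplex.moduleCatMk f g hfg.linearMap_comp_eq_zero) i y⟩

lemma exact_lmap_conn (i : ℕ) : Function.Exact (lmap 𝔞 i g) (conn 𝔞 hf hg hfg i) := fun x =>
  ⟨exists_of_δ_eq_zero 𝔞 (shortExact_of_exact hf hg hfg) i x, by
    rintro ⟨y, rfl⟩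
    exact δ_map_g 𝔞 (shortExact_of_exact hf hg hfg) i y⟩

lemma exact_conn_lmap (i : ℕ) : Function.Exact (conn 𝔞 hf hg hfg i) (lmap 𝔞 (i + 1) f) := fun x =>
  ⟨exists_of_map_f_eq_zero 𝔞 (shortExact_of_exact hf hg hfg) i x, by
    rintro ⟨y, rfl⟩
    exact map_f_δ 𝔞 (shortExact_of_exact hf hg hfg) i y⟩

lemma lmap_conn (a : A →ₗ[R] A') (b : B →ₗ[R] B') (c : C →ₗ[R] C') (hab : f' ∘ₗ a = b ∘ₗ f)
    (hbc : g' ∘ₗ b = c ∘ₗ g) (i : ℕ) (x : localCohomologyModule 𝔞 i C) :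
    lmap 𝔞 (i + 1) a (conn 𝔞 hf hg hfg i x) = conn 𝔞 hf' hg' hfg' i (lmap 𝔞 i c x) :=
  map_δ 𝔞 (shortExact_of_exact hf hg hfg) (shortExact_of_exact hf' hg' hfg')
    { τ₁ := ModuleCat.ofHom a
      τ₂ := ModuleCat.ofHom b
      τ₃ := ModuleCat.ofHom c
      comm₁₂ := ModuleCat.hom_ext hab
      comm₂₃ := ModuleCat.hom_ext hbc } i x

end connecting

/-- `H^0_𝔞(A) ≅ Γ_𝔞(A)`. -/
noncomputable def zeroEquiv (A : Type u) [AddCommGroup A] [Module R A] :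
    localCohomologyModule 𝔞 0 A ≃ₗ[R] powTorsion 𝔞 A :=
  LinearEquiv.ofInjective (zeroToSelf 𝔞 (ModuleCat.of R A)) (zeroToSelf_injective 𝔞) ≪≫ₗ
    LinearEquiv.ofEq _ _ (Submodule.ext (mem_range_zeroToSelf_iff 𝔞 (M := ModuleCat.of R A)))

lemma zeroEquiv_lmap (f : A →ₗ[R] B) (x : localCohomologyModule 𝔞 0 A) :
    (zeroEquiv 𝔞 B (lmap 𝔞 0 f x) : B) = f (zeroEquiv 𝔞 A x) :=
  zeroToSelf_map 𝔞 (ModuleCat.ofHom f) x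

lemma lmap_zero_surjective {f : A →ₗ[R] B} (hf : Function.Surjective f)
    (hA : powTorsion 𝔞 A = ⊤) : Function.Surjective (lmap 𝔞 0 f) := fun y => by
  obtain ⟨x, hx⟩ := hf (zeroEquiv 𝔞 B y)
  refine ⟨(zeroEquiv 𝔞 A).symm ⟨x, hA ▸ Submodule.mem_top⟩, ?_⟩
  refine (zeroEquiv 𝔞 B).injective (Subtype.ext ?_)
  rw [zeroEquiv_lmap, LinearEquiv.apply_symm_apply, hx]

/-- An embedding into an injective module lands in its power torsion, which is again injective by
`injective_powTorsion`. -/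
lemma exists_injective_powTorsion_eq_top [IsNoetherianRing R] (hA : powTorsion 𝔞 A = ⊤) :
    ∃ (E : Type u) (_ : AddCommGroup E) (_ : Module R E) (f : A →ₗ[R] E),
      Function.Injective f ∧ powTorsion 𝔞 E = ⊤ ∧ Module.Injective R E := by
  let E := Injective.under (ModuleCat.of R A)
  have : Module.Injective R E := by
    have : Injective (ModuleCat.of R E) := inferInstanceAs (Injective E)
    exact Module.injective_module_of_injective_object R E
  let f : A →ₗ[R] E := (Injective.ι (ModuleCat.of R A)).hom
  have hf : Function.Injective f := (ModuleCat.mono_iff_injective _).1 inferInstance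
  have hmem : ∀ a, f a ∈ powTorsion 𝔞 E := fun a => by
    obtain ⟨n, hn⟩ : a ∈ powTorsion 𝔞 A := hA ▸ Submodule.mem_top
    exact ⟨n, fun r hr => by rw [← map_smul, hn r hr, map_zero]⟩
  exact ⟨powTorsion 𝔞 E, inferInstance, inferInstance, f.codRestrict _ hmem,
    fun x y h => hf (congrArg Subtype.val h), powTorsion_powTorsion 𝔞 E,
    injective_powTorsion 𝔞 E⟩

/-- Power torsion modules have no higher local cohomology. -/
lemma subsingleton_of_powTorsion_eq_top [IsNoetherianRing R] (i : ℕ) (A : Type u) [AddCommGroup A]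
    [Module R A] (hA : powTorsion 𝔞 A = ⊤) :
    Subsingleton (localCohomologyModule 𝔞 (i + 1) A) := by
  induction i generalizing A with
  | zero =>
    -- As H¹(E) = 0, each class in H¹(A) comes from H⁰(E/A); this lifts to H⁰(E) because `E` is all
    -- torsion.
    obtain ⟨E, _, _, f, hf, hE, hinj⟩ := exists_injective_powTorsion_eq_top 𝔞 hA
    have : Injective (ModuleCat.of R E) := Module.injective_object_of_injective_module R E
    have := subsingleton_of_injective 𝔞 0 (ModuleCat.of R E)
    have hg := (LinearMap.range f).mkQ_surjective
    have hfg := LinearMap.exact_map_mkQ_range f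
    refine subsingleton_of_forall_eq 0 fun x => ?_
    obtain ⟨y, rfl⟩ := (exact_conn_lmap 𝔞 hf hg hfg 0 x).1 (Subsingleton.elim _ _)
    obtain ⟨z, rfl⟩ := lmap_zero_surjective 𝔞 hg hE y
    exact (exact_lmap_conn 𝔞 hf hg hfg 0).apply_apply_eq_zero z
  | succ i ih =>
    obtain ⟨E, _, _, f, hf, hE, hinj⟩ := exists_injective_powTorsion_eq_top 𝔞 hA
    have : Injective (ModuleCat.of R E) := Module.injective_object_of_injective_module R E
    have := subsingleton_of_injective 𝔞 (i + 1) (ModuleCat.of R E)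
    have hg := (LinearMap.range f).mkQ_surjective
    have hfg := LinearMap.exact_map_mkQ_range f
    -- Dimension shifting: the quotient is again torsion, so the induction hypothesis applies to it.
    have hQ : powTorsion 𝔞 (E ⧸ LinearMap.range f) = ⊤ := by
      refine eq_top_iff.2 fun q _ => ?_
      obtain ⟨e, rfl⟩ := hg q
      obtain ⟨n, hn⟩ : e ∈ powTorsion 𝔞 E := hE ▸ Submodule.mem_top
      exact ⟨n, fun r hr => by rw [← map_smul, hn r hr, map_zero]⟩
    have := ih _ hQ
    refine subsingleton_of_forall_eq 0 fun x => ?_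
    obtain ⟨y, rfl⟩ := (exact_conn_lmap 𝔞 hf hg hfg (i + 1) x).1 (Subsingleton.elim _ _)
    rw [Subsingleton.elim y 0, map_zero]

end localCohomology

end

/-! ### Partial sections and the splitting of Hom. -/

section linear

variable {R : Type*} [CommRing R]

/-- `φ` descends to D/ker p ≅ range p. In the application `p` is the connecting map of the auxiliary
sequence and `φ` is induced by the map of cokernels. -/
lemma exists_section_range {D B C : Type*} [AddCommGroup D] [Module R D] [AddCommGroup B]
    [Module R B] [AddCommGroup C] [Module R C] (p : D →ₗ[R] C) (φ : D →ₗ[R] B) (g : B →ₗ[R] C)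
    (hker : LinearMap.ker p ≤ LinearMap.ker φ) (hg : g ∘ₗ φ = p) :
    ∃ σ : LinearMap.range p →ₗ[R] B, ∀ z, g (σ z) = z := by
  refine ⟨(LinearMap.ker p).liftQ φ hker ∘ₗ p.quotKerEquivRange.symm.toLinearMap, ?_⟩
  rintro ⟨_, d, rfl⟩
  have : p.quotKerEquivRange.symm ⟨p d, d, rfl⟩ = (LinearMap.ker p).mkQ d :=
    p.quotKerEquivRange_symm_apply_image d _
  simp only [LinearMap.comp_apply, LinearEquiv.coe_coe, this]
  exact LinearMap.congr_fun hg d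

/-- If `0 → A → B → C` is exact and `B → C` has a section over the elements killed by `J`, then
`Hom(Q, -)` of it splits for every module `Q` killed by `J`. -/
lemma nonempty_hom_equiv_prod {Q A B C : Type*} [AddCommGroup Q] [Module R Q] [AddCommGroup A]
    [Module R A] [AddCommGroup B] [Module R B] [AddCommGroup C] [Module R C] (J : Ideal R)
    (hQ : ∀ r ∈ J, ∀ q : Q, r • q = 0) {f : A →ₗ[R] B} {g : B →ₗ[R] C}
    (hf : Function.Injective f) (hfg : Function.Exact f g)
    (σ : Submodule.torsionBySet R C J →ₗ[R] B) (hσ : ∀ z, g (σ z) = z) :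
    Nonempty ((Q →ₗ[R] B) ≃ₗ[R] (Q →ₗ[R] A) × (Q →ₗ[R] C)) := by
  have hF : Function.Injective (f.compRight R : (Q →ₗ[R] A) →ₗ[R] (Q →ₗ[R] B)) := fun u v h =>
    LinearMap.ext fun q => hf (LinearMap.congr_fun h q)
  have hFG : Function.Exact (f.compRight R : (Q →ₗ[R] A) →ₗ[R] (Q →ₗ[R] B))
      (g.compRight R : (Q →ₗ[R] B) →ₗ[R] (Q →ₗ[R] C)) := fun h => by
    constructor
    · intro hh
      have hm : ∀ q, h q ∈ LinearMap.range f := fun q =>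
        (hfg (h q)).1 (LinearMap.congr_fun hh q)
      refine ⟨(LinearEquiv.ofInjective f hf).symm.toLinearMap ∘ₗ h.codRestrict _ hm, ?_⟩
      ext q
      exact congrArg Subtype.val ((LinearEquiv.ofInjective f hf).apply_symm_apply ⟨h q, hm q⟩)
    · rintro ⟨u, rfl⟩
      exact LinearMap.ext fun q => hfg.apply_apply_eq_zero (u q)
  -- Maps out of `Q` only meet the `J`-torsion of `C`, so `σ` need not be defined elsewhere.
  have hmem : ∀ (h : Q →ₗ[R] C) q, h q ∈ Submodule.torsionBySet R C J := fun h q => by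
    rw [Submodule.mem_torsionBySet_iff]
    rintro ⟨r, hr⟩
    exact (h.map_smul r q).symm.trans (by rw [hQ r hr, map_zero])
  let L : (Q →ₗ[R] C) →ₗ[R] (Q →ₗ[R] B) :=
    { toFun h := σ ∘ₗ h.codRestrict _ (hmem h)
      map_add' u v := LinearMap.ext fun q => σ.map_add ⟨u q, hmem u q⟩ ⟨v q, hmem v q⟩
      map_smul' r u := LinearMap.ext fun q => σ.map_smul r ⟨u q, hmem u q⟩ }
  have hL : (g.compRight R : (Q →ₗ[R] B) →ₗ[R] (Q →ₗ[R] C)) ∘ₗ L = LinearMap.id :=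
    LinearMap.ext fun h => LinearMap.ext fun q => hσ ⟨h q, hmem h q⟩
  exact ⟨(hFG.splitSurjectiveEquiv hF ⟨L, hL⟩).1⟩

lemma exists_eq_sum_mul_of_mem_mul {I J : Ideal R} {x : R} (hx : x ∈ I * J) :
    ∃ (n : ℕ) (a b : Fin n → R), (∀ l, a l ∈ I) ∧ (∀ l, b l ∈ J) ∧ x = ∑ l, a l * b l := by
  refine Submodule.mul_induction_on hx (fun a ha b hb => ⟨1, fun _ => a, fun _ => b,
    fun _ => ha, fun _ => hb, by simp⟩) ?_
  rintro x y ⟨n, a, b, ha, hb, rfl⟩ ⟨m, a', b', ha', hb', rfl⟩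
  refine ⟨n + m, Fin.append a a', Fin.append b b', fun l => ?_, fun l => ?_, ?_⟩
  · induction l using Fin.addCases <;> simp [ha, ha']
  · induction l using Fin.addCases <;> simp [hb, hb']
  · simp [Fin.sum_univ_add]

end linear

/-! ### Filter regular elements have power torsion annihilator. -/

section filterRegular

variable {R : Type u} [CommRing R] [IsNoetherianRing R] {𝔞 : Ideal R}
  {M : Type v} [AddCommGroup M] [Module R M] {x : R}

/-- The annihilators of c^n m stabilise. If the stable c^n m is nonzero, its span has an associated
prime 𝔭 = Ann(r c^n m), and x ∈ 𝔭. If 𝔞 ⊆ 𝔭 then c ∈ 𝔭, and stability gives r c^n m = 0, which is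
absurd; otherwise filter regularity is violated. -/
lemma IsFilterRegularElement.exists_pow_smul_eq_zero (h : IsFilterRegularElement 𝔞 M x) {m : M}
    (hm : x • m = 0) {c : R} (hc : c ∈ 𝔞) : ∃ n, c ^ n • m = 0 := by
  let F : ℕ →o Ideal R :=
    { toFun n := LinearMap.ker (LinearMap.toSpanSingleton R M (c ^ n • m))
      monotone' := monotone_nat_of_le_succ fun n r hr => by
        rw [LinearMap.mem_ker, LinearMap.toSpanSingleton_apply] at hr ⊢
        rw [pow_succ', mul_smul, smul_comm, hr, smul_zero] }
  obtain ⟨n, hn⟩ := monotone_stabilizes_iff_noetherian.2 ‹IsNoetherianRing R› F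
  refine ⟨n, by_contra fun hne => ?_⟩
  have : Nontrivial (Submodule.span R {c ^ n • m}) :=
    ⟨⟨⟨_, Submodule.mem_span_singleton_self _⟩, 0, fun h => hne (congrArg Subtype.val h)⟩⟩
  obtain ⟨p, hp⟩ := associatedPrimes.nonempty R (Submodule.span R {c ^ n • m})
  have hpM := associatedPrimes.subset_of_injective (Submodule.injective_subtype _) hp
  obtain ⟨hprime, ⟨y, hy⟩, hpy⟩ := isAssociatedPrime_iff.1 hp
  obtain ⟨r, rfl⟩ := Submodule.mem_span_singleton.1 hy
  have hmem : ∀ s, s ∈ p ↔ s • r • c ^ n • m = 0 := fun s => by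
    rw [hpy, Submodule.mem_colon_singleton, Submodule.mem_bot, ← Subtype.coe_inj]
    rfl
  refine h.2 p hpM (fun hle => hprime.ne_top ?_) ?_
  · rw [Ideal.eq_top_iff_one, hmem, one_smul]
    have h1 := (hmem c).1 (hle hc)
    have h2 : r ∈ F (n + 1) := by
      rw [smul_comm c r, ← mul_smul c, ← pow_succ'] at h1
      exact h1
    rw [← hn (n + 1) (by lia)] at h2
    exact h2
  · rw [hmem, smul_comm, smul_comm x (c ^ n) m, hm, smul_zero, smul_zero]

lemma IsFilterRegularElement.mem_powTorsion (h : IsFilterRegularElement 𝔞 M x) {m : M}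
    (hm : x • m = 0) : m ∈ powTorsion 𝔞 M := by
  let I : Ideal R := LinearMap.ker (LinearMap.toSpanSingleton R M m)
  have hle : 𝔞 ≤ I.radical := fun c hc => h.exists_pow_smul_eq_zero hm hc
  obtain ⟨n, hn⟩ := Ideal.exists_pow_le_of_le_radical_of_fg hle (IsNoetherian.noetherian 𝔞)
  exact ⟨n, fun r hr => hn hr⟩

omit [IsNoetherianRing R] in
lemma IsFilterRegularElement.of_linearEquiv {N : Type*} [AddCommGroup N] [Module R N]
    (e : M ≃ₗ[R] N) (h : IsFilterRegularElement 𝔞 M x) : IsFilterRegularElement 𝔞 N x :=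
  ⟨h.1, fun p hp => h.2 p (by rwa [LinearEquiv.AssociatedPrimes.eq e])⟩

end filterRegular

/-! ### Splitting the local cohomology of M/xM. -/

namespace localCohomology

variable {R : Type u} [CommRing R] [IsNoetherianRing R] {𝔞 : Ideal R}
  {M : Type u} [AddCommGroup M] [Module R M] {x : R}

section torsionQuotient

variable {K : Submodule R M} (hK : K ≤ powTorsion 𝔞 M)

include hK

omit [IsNoetherianRing R] in
lemma powTorsion_eq_top_of_le : powTorsion 𝔞 K = ⊤ := by
  refine eq_top_iff.2 fun m _ => ?_
  obtain ⟨n, hn⟩ := hK m.2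
  exact ⟨n, fun r hr => Subtype.ext (hn r hr)⟩

/-- The obstruction lies in H^(i+1)(K) = 0, as K is torsion; degree 0 is included, whereas
injectivity holds only in positive degrees. -/
lemma lmap_mkQ_surjective (i : ℕ) : Function.Surjective (lmap 𝔞 i K.mkQ) := fun y => by
  have := subsingleton_of_powTorsion_eq_top 𝔞 i K (powTorsion_eq_top_of_le hK)
  exact (exact_lmap_conn 𝔞 K.injective_subtype K.mkQ_surjective (LinearMap.exact_subtype_mkQ K)
    i y).1 (Subsingleton.elim _ _)

lemma lmap_mkQ_injective (i : ℕ) : Function.Injective (lmap 𝔞 (i + 1) K.mkQ) := by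
  have := subsingleton_of_powTorsion_eq_top 𝔞 i K (powTorsion_eq_top_of_le hK)
  rw [injective_iff_map_eq_zero]
  intro y hy
  obtain ⟨z, rfl⟩ := (exact_lmap_lmap 𝔞 K.injective_subtype K.mkQ_surjective
    (LinearMap.exact_subtype_mkQ K) (i + 1) y).1 hy
  rw [Subsingleton.elim z 0, map_zero]

end torsionQuotient

omit [IsNoetherianRing R] in
lemma smul_eq_zero_of_mem_powTorsion {r : R}
    (hr : ∀ z : localCohomologyModule 𝔞 0 M, r • z = 0) {m : M} (hm : m ∈ powTorsion 𝔞 M) :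
    r • m = 0 := by
  have h := hr ((zeroEquiv 𝔞 M).symm ⟨m, hm⟩)
  rw [← map_smul, LinearEquiv.map_eq_zero_iff] at h
  exact congrArg Subtype.val h

/-- The splitting of local cohomology of `M/xM`, in degrees in which `J` kills `H^i_𝔞(M)`, for
`x ∈ J ^ 2` with power torsion annihilator in `M`: the long exact sequence breaks up, and the
connecting homomorphism has a section over the elements killed by `J`. -/
theorem exists_splitting {J : Ideal R} (hx : ∀ m : M, x • m = 0 → m ∈ powTorsion 𝔞 M)
    (hxJ : x ∈ J * J) (h₀ : ∀ r ∈ J, ∀ z : localCohomologyModule 𝔞 0 M, r • z = 0)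
    {i : ℕ} (hi : ∀ r ∈ J, ∀ z : localCohomologyModule 𝔞 i M, r • z = 0) :
    ∃ (f : localCohomologyModule 𝔞 i M →ₗ[R] localCohomologyModule 𝔞 i (QuotSMulTop x M))
      (g : localCohomologyModule 𝔞 i (QuotSMulTop x M) →ₗ[R] localCohomologyModule 𝔞 (i + 1) M)
      (σ : Submodule.torsionBySet R (localCohomologyModule 𝔞 (i + 1) M) J →ₗ[R]
        localCohomologyModule 𝔞 i (QuotSMulTop x M)),
      Function.Injective f ∧ Function.Exact f g ∧ ∀ z, g (σ z) = z := by
  obtain ⟨n, a, b, ha, hb, hab⟩ := exists_eq_sum_mul_of_mem_mul hxJ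
  let K : Submodule R M := LinearMap.ker (LinearMap.lsmul R M x)
  have hK : K ≤ powTorsion 𝔞 M := fun m hm => hx m hm
  let xbar : (M ⧸ K) →ₗ[R] M := K.liftQ (LinearMap.lsmul R M x) le_rfl
  let q : M →ₗ[R] QuotSMulTop x M := Submodule.mkQ _
  have hxbar : Function.Injective xbar := by
    rw [← LinearMap.ker_eq_bot]
    exact Submodule.ker_liftQ_eq_bot _ _ _ le_rfl
  have hq : Function.Surjective q := Submodule.mkQ_surjective _
  have hxq : Function.Exact xbar q := by
    rw [LinearMap.exact_iff, Submodule.ker_mkQ, Submodule.range_liftQ]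
    ext m
    simp [Submodule.mem_smul_pointwise_iff_exists]
  -- Each `b l` kills K because K ⊆ Γ_𝔞(M) ≅ H⁰(M), which `J` annihilates.
  let bbar : (M ⧸ K) →ₗ[R] (Fin n → M) := K.liftQ (LinearMap.pi fun l => LinearMap.lsmul R M (b l))
    (fun m hm => funext fun l => smul_eq_zero_of_mem_powTorsion (h₀ _ (hb l)) (hK hm))
  let aa : (Fin n → M) →ₗ[R] M := ∑ l, a l • LinearMap.proj l
  have haa : aa ∘ₗ bbar = xbar := by
    refine Submodule.linearMap_qext _ (LinearMap.ext fun m => ?_)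
    simp [aa, bbar, xbar, hab, mul_smul]
    rfl
  have hbbar : Function.Injective bbar := by
    refine Function.Injective.of_comp (f := aa) ?_
    rw [← LinearMap.coe_comp, haa]
    exact hxbar
  have hqb := (LinearMap.range bbar).mkQ_surjective
  have hbq := LinearMap.exact_map_mkQ_range bbar
  let c : ((Fin n → M) ⧸ LinearMap.range bbar) →ₗ[R] QuotSMulTop x M :=
    (LinearMap.range bbar).liftQ (q ∘ₗ aa) (by
      rintro _ ⟨y, rfl⟩
      rw [LinearMap.mem_ker, LinearMap.comp_apply, ← LinearMap.comp_apply aa, haa]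
      exact hxq.apply_apply_eq_zero y)
  have hconn : conn 𝔞 hxbar hq hxq i ∘ₗ lmap 𝔞 i c = conn 𝔞 hbbar hqb hbq i :=
    LinearMap.ext fun y => by
      rw [LinearMap.comp_apply, ← lmap_conn 𝔞 hbbar hqb hbq hxbar hq hxq LinearMap.id aa c
        (by rw [haa]; rfl) rfl, lmap_id, LinearMap.id_apply]
  -- The kernel is the image of H^i(Mⁿ), on which the induced map is zero since every `a l` kills
  -- H^i(M).
  have hker : LinearMap.ker (conn 𝔞 hbbar hqb hbq i) ≤ LinearMap.ker (lmap 𝔞 i c) := fun y hy => by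
    obtain ⟨z, rfl⟩ := (exact_lmap_conn 𝔞 hbbar hqb hbq i y).1 hy
    have h0 : lmap 𝔞 i aa z = 0 := by
      simp only [aa, lmap_sum, lmap_smul, LinearMap.sum_apply, LinearMap.smul_apply]
      exact Finset.sum_eq_zero fun l _ => hi _ (ha l) _
    rw [LinearMap.mem_ker, ← lmap_comp_apply]
    change lmap 𝔞 i (q ∘ₗ aa) z = 0
    rw [lmap_comp_apply, h0, map_zero]
  obtain ⟨σ, hσ⟩ := exists_section_range _ _ _ hker hconn
  let e : localCohomologyModule 𝔞 (i + 1) M ≃ₗ[R] localCohomologyModule 𝔞 (i + 1) (M ⧸ K) :=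
    LinearEquiv.ofBijective (lmap 𝔞 (i + 1) K.mkQ)
      ⟨lmap_mkQ_injective hK i, lmap_mkQ_surjective hK (i + 1)⟩
  -- The obstruction to lifting `z` is its image in H^(i+1)(Mⁿ), with components b_l z = 0.
  have he : ∀ z : Submodule.torsionBySet R (localCohomologyModule 𝔞 (i + 1) M) J,
      e z ∈ LinearMap.range (conn 𝔞 hbbar hqb hbq i) := fun z => by
    refine (exact_conn_lmap 𝔞 hbbar hqb hbq i _).1 ?_
    change lmap 𝔞 (i + 1) bbar (lmap 𝔞 (i + 1) K.mkQ z) = 0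
    have h1 : bbar ∘ₗ K.mkQ = ∑ l, b l • LinearMap.single R (fun _ : Fin n => M) l := by
      ext m l
      simp [bbar, Finset.sum_apply, Pi.single_apply]
      rfl
    rw [← lmap_comp_apply, h1]
    simp only [lmap_sum, lmap_smul, LinearMap.sum_apply, LinearMap.smul_apply]
    refine Finset.sum_eq_zero fun l _ => ?_
    rw [← map_smul, (Submodule.mem_torsionBySet_iff _ _).1 z.2 ⟨b l, hb l⟩, map_zero]
  have hxJ' : x ∈ J := Ideal.mul_le_left hxJ
  refine ⟨lmap 𝔞 i q, e.symm.toLinearMap ∘ₗ conn 𝔞 hxbar hq hxq i,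
    σ ∘ₗ (e.toLinearMap ∘ₗ Submodule.subtype _).codRestrict _ he, ?_, ?_, ?_⟩
  · rw [injective_iff_map_eq_zero]
    intro y hy
    obtain ⟨z, rfl⟩ := (exact_lmap_lmap 𝔞 hxbar hq hxq i y).1 hy
    -- H^i of `xbar` vanishes: its composite with the surjection H^i(M) → H^i(M/K) is multiplication
    -- by x ∈ J.
    obtain ⟨w, rfl⟩ := lmap_mkQ_surjective hK i z
    have h1 : xbar ∘ₗ K.mkQ = x • LinearMap.id := rfl
    rw [← lmap_comp_apply, h1, lmap_smul, lmap_id]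
    exact hi x hxJ' w
  · intro y
    rw [← exact_lmap_conn 𝔞 hxbar hq hxq i y]
    exact e.symm.map_eq_zero_iff
  · intro z
    refine e.symm_apply_eq.2 ?_
    exact hσ _

end localCohomology

/-! ### Pascal's rule for products of powers. -/

section binomial

variable {R : Type*} [CommRing R] (A : ℕ → Type*) [∀ i, AddCommGroup (A i)] [∀ i, Module R (A i)]

/-- Sequences are pairs of their first term and their tail. -/
def LinearEquiv.piNatEquivProd : (∀ i, A i) ≃ₗ[R] A 0 × ∀ i, A (i + 1) where
  toFun f := (f 0, fun i => f (i + 1))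
  map_add' _ _ := rfl
  map_smul' _ _ := rfl
  invFun p i := Nat.casesOn i p.1 p.2
  left_inv f := funext fun i => by cases i <;> rfl
  right_inv _ := rfl

/-- A product of binary products is a binary product of products. -/
def LinearEquiv.piProdEquiv {ι : Type*} (B C : ι → Type*) [∀ i, AddCommGroup (B i)]
    [∀ i, Module R (B i)] [∀ i, AddCommGroup (C i)] [∀ i, Module R (C i)] :
    (∀ i, B i × C i) ≃ₗ[R] (∀ i, B i) × ∀ i, C i where
  toFun f := (fun i => (f i).1, fun i => (f i).2)
  map_add' _ _ := rfl
  map_smul' _ _ := rfl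
  invFun p i := (p.1 i, p.2 i)

/-- `Bᵐ⁺ⁿ ≃ Bᵐ × Bⁿ`. -/
def LinearEquiv.finAddPiEquivProd (B : Type*) [AddCommGroup B] [Module R B] (m n : ℕ) :
    (Fin (m + n) → B) ≃ₗ[R] (Fin m → B) × (Fin n → B) :=
  LinearEquiv.funCongrLeft R B finSumFinEquiv ≪≫ₗ
    LinearEquiv.sumArrowLequivProdArrow (Fin m) (Fin n) R B

/-- The product `∏ᵢ Aᵢ ^ (j choose i)` satisfies Pascal's recursion. -/
def pascalEquiv (j : ℕ) : (∀ i, Fin ((j + 1).choose i) → A i) ≃ₗ[R]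
    (∀ i, Fin (j.choose i) → A i) × ∀ i, Fin (j.choose i) → A (i + 1) :=
  LinearEquiv.piNatEquivProd (fun i => Fin ((j + 1).choose i) → A i) ≪≫ₗ
  (((LinearEquiv.funCongrLeft R (A 0)
    (finCongr (by simp : j.choose 0 = (j + 1).choose 0))).prodCongr
    -- Each A_(i+1) power splits by Pascal; the swap then lets the exponents C(j, i+1) rejoin the
    -- factor at 0.
    ((LinearEquiv.piCongrRight fun i =>
      LinearEquiv.funCongrLeft R (A (i + 1)) (finCongr (Nat.choose_succ_succ' j i).symm) ≪≫ₗ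
      LinearEquiv.finAddPiEquivProd (A (i + 1)) (j.choose i) (j.choose (i + 1))) ≪≫ₗ
      LinearEquiv.piProdEquiv _ _ ≪≫ₗ LinearEquiv.prodComm R _ _)) ≪≫ₗ
  (LinearEquiv.prodAssoc R _ _ _).symm ≪≫ₗ
  ((LinearEquiv.piNatEquivProd (fun i => Fin (j.choose i) → A i)).symm.prodCongr
    (LinearEquiv.refl R _)))

/-- Restriction of `∏ᵢ Aᵢ ^ (j choose i)` to the finitely many nonzero factors. -/
noncomputable def choosePiEquiv (j : ℕ) : (∀ i, Fin (j.choose i) → A i) ≃ₗ[R]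
    ∀ i : Fin (j + 1), Fin (j.choose i) → A i :=
  LinearEquiv.ofBijective (LinearMap.pi fun i : Fin (j + 1) => LinearMap.proj (i : ℕ)) (by
    constructor
    · intro f g h
      funext i l
      have hi : i < j + 1 := by
        by_contra hi
        rw [Nat.choose_eq_zero_of_lt (by lia)] at l
        exact l.elim0
      exact congrFun (congrFun h ⟨i, hi⟩) l
    · intro g
      refine ⟨fun i => if h : i < j + 1 then g ⟨i, h⟩ else 0, funext fun i => ?_⟩
      exact dif_pos i.2)

/-- The product `∏ᵢ Aᵢ ^ (0 choose i)` has the single factor `A₀`. -/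
def zeroChoosePiEquiv : (∀ i, Fin (Nat.choose 0 i) → A i) ≃ₗ[R] A 0 where
  toFun f := f 0 (0 : Fin 1)
  map_add' _ _ := rfl
  map_smul' _ _ := rfl
  invFun a i := Nat.casesOn i (fun _ => a) fun _ l => l.elim0
  left_inv f := funext fun i => by
    cases i with
    | zero => exact funext fun l => congrArg (f 0) (Subsingleton.elim (α := Fin 1) 0 l)
    | succ i => exact funext fun l => l.elim0
  right_inv _ := rfl

variable {A} in
lemma nonempty_choose_succ_equiv {B : ℕ → Type*} [∀ i, AddCommGroup (B i)] [∀ i, Module R (B i)]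
    (j : ℕ) (h : ∀ i ≤ j, Nonempty (B i ≃ₗ[R] A i × A (i + 1))) :
    Nonempty ((∀ i, Fin (j.choose i) → B i) ≃ₗ[R] ∀ i, Fin ((j + 1).choose i) → A i) := by
  let F : ∀ i, (Fin (j.choose i) → B i) ≃ₗ[R]
      (Fin (j.choose i) → A i) × (Fin (j.choose i) → A (i + 1)) := fun i =>
    if hi : i ≤ j then
      (LinearEquiv.piCongrRight fun _ => (h i hi).some) ≪≫ₗ LinearEquiv.piProdEquiv _ _
    else
      -- Beyond `j` both exponents are 0, so no splitting of `B i` is needed.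
      have : IsEmpty (Fin (j.choose i)) := by
        rw [Nat.choose_eq_zero_of_lt (by lia)]; infer_instance
      { toFun := fun _ => 0
        invFun := fun _ => 0
        map_add' := fun _ _ => Subsingleton.elim _ _
        map_smul' := fun _ _ => Subsingleton.elim _ _
        left_inv := fun _ => Subsingleton.elim _ _
        right_inv := fun _ => Subsingleton.elim _ _ }
  exact ⟨LinearEquiv.piCongrRight F ≪≫ₗ LinearEquiv.piProdEquiv _ _ ≪≫ₗ (pascalEquiv A j).symm⟩

end binomial

/-! ### Passing from a filter regular sequence to its tail. -/

section filterRegular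

variable {R : Type u} [CommRing R] {𝔞 : Ideal R} {M : Type v} [AddCommGroup M] [Module R M]

/-- `M` modulo the empty sequence. -/
noncomputable def quotPrefixZeroEquiv (M : Type v) [AddCommGroup M] [Module R M] (xs : List R) :
    QuotPrefix M xs 0 ≃ₗ[R] M :=
  Submodule.quotEquivOfEqBot _ (by simp)

/-- `M/(x,x₁,…,xⱼ)M` is `N/(x₁,…,xⱼ)N` for `N = M/xM`. -/
def quotPrefixConsEquiv (M : Type v) [AddCommGroup M] [Module R M] (x : R) (xs : List R) (j : ℕ) :
    QuotPrefix M (x :: xs) (j + 1) ≃ₗ[R] QuotPrefix (QuotSMulTop x M) xs j :=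
  Submodule.quotOfListConsSMulTopEquivQuotSMulTopInner M x (xs.take j)

lemma IsFilterRegularSequence.head {x : R} {xs : List R}
    (h : IsFilterRegularSequence 𝔞 M (x :: xs)) : IsFilterRegularElement 𝔞 M x :=
  (h 0 (by simp)).of_linearEquiv (quotPrefixZeroEquiv M _)

lemma IsFilterRegularSequence.tail {x : R} {xs : List R}
    (h : IsFilterRegularSequence 𝔞 M (x :: xs)) :
    IsFilterRegularSequence 𝔞 (QuotSMulTop x M) xs := fun i hi =>
  (h (i + 1) (by simpa using hi)).of_linearEquiv (quotPrefixConsEquiv M x xs i)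

end filterRegular

/-! ### Induction on the length of the prefix. -/

namespace localCohomology

variable {R : Type u} [CommRing R] {𝔞 : Ideal R}

/-- The image of a map from R/𝔞^k is killed by 𝔞^k, so it lies in Γ_𝔞(M) ≅ H⁰(M). -/
lemma nonempty_hom_zeroEquiv {k : ℕ} (M : Type u) [AddCommGroup M] [Module R M] :
    Nonempty (((R ⧸ 𝔞 ^ k) →ₗ[R] localCohomologyModule 𝔞 0 M) ≃ₗ[R] ((R ⧸ 𝔞 ^ k) →ₗ[R] M)) := by
  refine ⟨LinearEquiv.ofBijective
    (((powTorsion 𝔞 M).subtype ∘ₗ (zeroEquiv 𝔞 M).toLinearMap).compRight R)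
    ⟨fun u v h => ?_, fun h => ?_⟩⟩
  · exact LinearMap.ext fun q => (zeroEquiv 𝔞 M).injective (Subtype.ext (LinearMap.congr_fun h q))
  · have hm : ∀ q, h q ∈ powTorsion 𝔞 M := fun q => ⟨k, fun r hr => by
      have : r • q = 0 := by
        obtain ⟨s, rfl⟩ := Ideal.Quotient.mk_surjective q
        exact Ideal.Quotient.eq_zero_iff_mem.2 (Ideal.mul_mem_right s _ hr)
      rw [← map_smul, this, map_zero]⟩
    refine ⟨(zeroEquiv 𝔞 M).symm.toLinearMap ∘ₗ h.codRestrict _ hm, ?_⟩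
    ext
    simp

/-- `Hom(R/𝔞ᵏ, M/(x₁,…,xⱼ)M)` in terms of the local cohomology of `M`. -/
theorem nonempty_hom_quotPrefix_equiv [IsNoetherianRing R] {n₀ k : ℕ} (hk : k ≤ n₀) (j : ℕ)
    (xs : List R) (M : Type u) [AddCommGroup M] [Module R M]
    (hann : ∀ i < xs.length, ∀ r ∈ 𝔞 ^ n₀, ∀ z : localCohomologyModule 𝔞 i M, r • z = 0)
    (hreg : IsFilterRegularSequence 𝔞 M xs) (hxs : ∀ x ∈ xs, x ∈ 𝔞 ^ (2 * n₀))
    (hj : j ≤ xs.length) :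
    Nonempty (((R ⧸ 𝔞 ^ k) →ₗ[R] QuotPrefix M xs j) ≃ₗ[R]
      ∀ i, (Fin (j.choose i) → ((R ⧸ 𝔞 ^ k) →ₗ[R] localCohomologyModule 𝔞 i M))) := by
  induction j generalizing xs M with
  | zero =>
    obtain ⟨e⟩ := nonempty_hom_zeroEquiv (𝔞 := 𝔞) (k := k) M
    refine ⟨(quotPrefixZeroEquiv M xs).congrRight ≪≫ₗ e.symm ≪≫ₗ
      (zeroChoosePiEquiv fun i => (R ⧸ 𝔞 ^ k) →ₗ[R] localCohomologyModule 𝔞 i M).symm⟩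
  | succ j ih =>
    obtain _ | ⟨x, xs⟩ := xs
    · simp at hj
    have hxJ : x ∈ 𝔞 ^ n₀ * 𝔞 ^ n₀ := by
      rw [← pow_add, ← two_mul]
      exact hxs x (by simp)
    have hsplit := fun i (hi : i < xs.length + 1) => exists_splitting (𝔞 := 𝔞)
      (fun _ => hreg.head.mem_powTorsion) hxJ
      (hann 0 (by simp)) (hann i hi)
    obtain ⟨e⟩ := ih xs (QuotSMulTop x M) (fun i hi r hr z => by
      obtain ⟨f, g, σ, hf, hfg, hσ⟩ := hsplit i (by lia)
      have hg : g z ∈ Submodule.torsionBySet R (localCohomologyModule 𝔞 (i + 1) M)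
          (𝔞 ^ n₀ : Ideal R) := by
        rw [Submodule.mem_torsionBySet_iff]
        exact fun s => hann (i + 1) (by simpa using hi) s s.2 (g z)
      -- z = f y + σ (g z), with both y and g z killed by 𝔞^n₀. The splitting keeps the exponent n₀;
      -- exactness alone would only give 2n₀.
      obtain ⟨y, hy⟩ := (hfg (z - σ ⟨g z, hg⟩)).1 (by rw [map_sub, hσ, sub_self])
      rw [sub_eq_iff_eq_add.1 hy.symm, smul_add, ← map_smul, ← map_smul,
        hann i (by simp; lia) r hr y, map_zero, zero_add]
      have : r • (⟨g z, hg⟩ : Submodule.torsionBySet R (localCohomologyModule 𝔞 (i + 1) M)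
          (𝔞 ^ n₀ : Ideal R)) = 0 :=
        Subtype.ext (hann (i + 1) (by simpa using hi) r hr (g z))
      rw [this, map_zero]) hreg.tail (fun y hy => hxs y (by simp [hy])) (by simpa using hj)
    obtain ⟨e'⟩ := nonempty_choose_succ_equiv (R := R)
      (A := fun i => (R ⧸ 𝔞 ^ k) →ₗ[R] localCohomologyModule 𝔞 i M)
      (B := fun i => (R ⧸ 𝔞 ^ k) →ₗ[R] localCohomologyModule 𝔞 i (QuotSMulTop x M)) j
      (fun i hi => by
        -- Here i + 1 may reach the length of the full sequence, where H^(i+1)(M) need not be killed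
        -- by 𝔞^n₀; a section over the torsion is enough.
        obtain ⟨f, g, σ, hf, hfg, hσ⟩ := hsplit i (by simp at hj; lia)
        refine nonempty_hom_equiv_prod (𝔞 ^ n₀) (fun r hr q => ?_) hf hfg σ hσ
        obtain ⟨s, rfl⟩ := Ideal.Quotient.mk_surjective q
        exact Ideal.Quotient.eq_zero_iff_mem.2
          (Ideal.mul_mem_right s _ (Ideal.pow_le_pow_right hk hr)))
    exact ⟨(quotPrefixConsEquiv M x xs j).congrRight ≪≫ₗ e ≪≫ₗ e'⟩

end localCohomology

open localCohomology in
theorem corollary4p2 {R : Type u} [CommRing R] [IsNoetherianRing R] (𝔞 : Ideal R)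
    (M : Type u) [AddCommGroup M] [Module R M] [Module.Finite R M]
    (t n₀ : ℕ) (ht : 0 < t) (hn₀ : 0 < n₀)
    (hann : ∀ i < t, 𝔞 ^ n₀ • (⊤ : Submodule R (localCohomologyModule 𝔞 i M)) = ⊥) :
    (∀ xs : List R, xs.length = t → IsFilterRegularSequence 𝔞 M xs →
      (∀ x ∈ xs, x ∈ 𝔞 ^ (2 * n₀)) →
      ∀ k ≤ n₀, ∀ j ≤ t,
        Nonempty (((R ⧸ 𝔞 ^ k) →ₗ[R] QuotPrefix M xs j) ≃ₗ[R]
          ⨁ i : Fin (j + 1),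
            (Fin (j.choose i) → ((R ⧸ 𝔞 ^ k) →ₗ[R] localCohomologyModule 𝔞 i M)))) ∧
    (∀ xs ys : List R, xs.length = t → ys.length = t →
      IsFilterRegularSequence 𝔞 M xs → IsFilterRegularSequence 𝔞 M ys →
      (∀ x ∈ xs, x ∈ 𝔞 ^ (2 * n₀)) → (∀ y ∈ ys, y ∈ 𝔞 ^ (2 * n₀)) →
      ∀ k ≤ n₀, ∀ j ≤ t,
        Nonempty (((R ⧸ 𝔞 ^ k) →ₗ[R] QuotPrefix M xs j) ≃ₗ[R]
          ((R ⧸ 𝔞 ^ k) →ₗ[R] QuotPrefix M ys j))) := by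
  have hann' : ∀ i < t, ∀ r ∈ 𝔞 ^ n₀, ∀ z : localCohomologyModule 𝔞 i M, r • z = 0 :=
    fun i hi r hr z => (Submodule.mem_bot R).1
      (hann i hi ▸ Submodule.smul_mem_smul hr Submodule.mem_top)
  refine ⟨fun xs hlen hreg hxs k hk j hj => ?_,
    fun xs ys hlen hlen' hreg hreg' hxs hys k hk j hj => ?_⟩
  · subst hlen
    obtain ⟨e⟩ := nonempty_hom_quotPrefix_equiv hk j xs M hann' hreg hxs hj
    exact ⟨e ≪≫ₗ choosePiEquiv _ j ≪≫ₗ (DirectSum.linearEquivFunOnFintype R _ _).symm⟩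
  · obtain ⟨e⟩ := nonempty_hom_quotPrefix_equiv hk j xs M (hlen ▸ hann') hreg hxs (hlen ▸ hj)
    obtain ⟨e'⟩ := nonempty_hom_quotPrefix_equiv hk j ys M (hlen' ▸ hann') hreg' hys (hlen' ▸ hj)
    exact ⟨e ≪≫ₗ e'.symm⟩
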